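/- Let $\Bbbk$ be an algebraically closed field of characteristic zero and let $X\subseteq\mathbb{P}^N=\mathbb{P}^N_{\Bbbk}$ be a projective variety, i.e. a non-empty Zariski closed subset (not necessarily irreducible or non-degenerate), and let $n=\dim X$. For an integer $s\ge 1$, the $s$-th secant variety of $X$ is the Zariski closure $$\sigma_s(X):=\overline{\bigcup_{P_1,\ldots,P_s\in X}\langle P_1,\ldots,P_s\rangle}\subseteq\mathbb{P}^N,$$ where $\langle P_1,\ldots,P_s\rangle$ denotes the linear span, and $X$ is called $s$-defective if $$\dim\sigma_s(X)<\min\{N,\;sn+s-1\}.$$ Let $s\ge 1$. If $X$ is $s$-defective and $\sigma_{s+1}(X)\neq\mathbb{P}^N$, then $X$ is also $(s+1)$-defective. -/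

import Mathlib

open scoped LinearAlgebra.Projectivization

noncomputable section

namespace SecantVariety

/-- The projective space `ℙ^N` over `K`: lines through the origin in `K^(N+1)`. -/
abbrev ProjSpace (K : Type*) [Field K] (N : ℕ) : Type _ := ℙ K (Fin (N + 1) → K)

variable {K : Type*} [Field K] {N : ℕ}

/-- The common zeros in `ℙ^N` of a set of polynomials in the homogeneous coordinates. It is used
only for sets of homogeneous polynomials, where the choice of the representative is irrelevant
(see `eval_rep_eq_zero_iff`). -/
def projZeroLocus (S : Set (MvPolynomial (Fin (N + 1)) K)) : Set (ProjSpace K N) :=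
  {P | ∀ f ∈ S, MvPolynomial.eval P.rep f = 0}

/-- A set of polynomials all of whose members are homogeneous (of possibly different degrees). -/
def AllHomogeneous (S : Set (MvPolynomial (Fin (N + 1)) K)) : Prop :=
  ∀ f ∈ S, ∃ d : ℕ, f.IsHomogeneous d

theorem eval_rep_eq_zero_iff {f : MvPolynomial (Fin (N + 1)) K} {d : ℕ} (hf : f.IsHomogeneous d)
    (v : Fin (N + 1) → K) (hv : v ≠ 0) :
    MvPolynomial.eval (Projectivization.mk K v hv).rep f = 0 ↔ MvPolynomial.eval v f = 0 := by
  obtain ⟨a, ha⟩ := Projectivization.exists_smul_eq_mk_rep K v hv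
  have h : (a : K) ^ d ≠ 0 := pow_ne_zero _ a.ne_zero
  have e : MvPolynomial.eval (Projectivization.mk K v hv).rep f
      = (a : K) ^ d * MvPolynomial.eval v f := by
    rw [← ha, MvPolynomial.eval_eq', MvPolynomial.eval_eq', Finset.mul_sum]
    refine Finset.sum_congr rfl fun m hm => ?_
    have hd : ∑ i, m i = d := by
      rw [← Finsupp.degree_eq_sum, Finsupp.degree_eq_weight_one]
      exact hf (MvPolynomial.mem_support_iff.mp hm)
    simp only [Units.smul_def, Pi.smul_apply, smul_eq_mul, mul_pow, Finset.prod_mul_distrib,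
      Finset.prod_pow_eq_pow_sum, hd]
    ring
  rw [e, mul_eq_zero, or_iff_right h]

/-- The Zariski topology on `ℙ^N`: the closed sets are the common zeros of sets of homogeneous
polynomials. -/
instance zariskiTopology : TopologicalSpace (ProjSpace K N) :=
  TopologicalSpace.ofClosed
    {Z | ∃ S : Set (MvPolynomial (Fin (N + 1)) K), AllHomogeneous S ∧ Z = projZeroLocus S}
    ⟨{1}, by
      rintro f rfl
      exact ⟨0, MvPolynomial.isHomogeneous_one _ _⟩, by
      ext P
      simp [projZeroLocus]⟩
    (by
      intro A hA
      refine ⟨{f | ∃ S, AllHomogeneous S ∧ projZeroLocus S ∈ A ∧ f ∈ S}, ?_, ?_⟩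
      · rintro f ⟨S, hS, -, hf⟩
        exact hS f hf
      · ext P
        constructor
        · rintro h f ⟨S, -, hSA, hf⟩
          exact h _ hSA f hf
        · intro h Z hZ
          obtain ⟨S, hS, rfl⟩ := hA hZ
          exact fun f hf => h f ⟨S, hS, hZ, hf⟩)
    (by
      rintro _ ⟨S, hS, rfl⟩ _ ⟨T, hT, rfl⟩
      refine ⟨{h | ∃ f ∈ S, ∃ g ∈ T, h = f * g}, ?_, ?_⟩
      · rintro _ ⟨f, hf, g, hg, rfl⟩
        obtain ⟨a, ha⟩ := hS f hf
        obtain ⟨b, hb⟩ := hT g hg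
        exact ⟨a + b, ha.mul hb⟩
      · ext P
        constructor
        · rintro (h | h) _ ⟨f, hf, g, hg, rfl⟩
          · rw [map_mul, h f hf, zero_mul]
          · rw [map_mul, h g hg, mul_zero]
        · intro h
          by_contra hc
          simp only [Set.mem_union, not_or, projZeroLocus, Set.mem_ofPred_eq, not_forall] at hc
          obtain ⟨⟨f, hf, hf0⟩, ⟨g, hg, hg0⟩⟩ := hc
          have := h _ ⟨f, hf, g, hg, rfl⟩
          rw [map_mul] at this
          exact (mul_ne_zero hf0 hg0) this)

theorem isClosed_iff (Z : Set (ProjSpace K N)) :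
    IsClosed Z ↔
      ∃ S : Set (MvPolynomial (Fin (N + 1)) K), AllHomogeneous S ∧ Z = projZeroLocus S := by
  rw [← isOpen_compl_iff]
  change Zᶜᶜ ∈ _ ↔ _
  rw [compl_compl]
  rfl

/-- The dimension of a subset of `ℙ^N` with the induced Zariski topology (`⊥` for the empty
set). -/
def projDim (Z : Set (ProjSpace K N)) : WithBot ℕ∞ := topologicalKrullDim Z

/-- The `s`-th secant variety of `X ⊆ ℙ^N`: the Zariski closure of the union of the linear spans
`⟨P₁, …, Pₛ⟩` of `s` points of `X`. -/
def secantVariety (s : ℕ) (X : Set (ProjSpace K N)) : Set (ProjSpace K N) :=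
  closure (⋃ (P : Fin s → ProjSpace K N) (_ : ∀ i, P i ∈ X),
    (Projectivization.Subspace.span (Set.range P) : Set (ProjSpace K N)))

/-- `X ⊆ ℙ^N`, of dimension `n`, is `s`-defective (`s ≥ 1`) if
`dim σₛ(X) < min {N, s n + s - 1}`. -/
def IsDefective (s : ℕ) (X : Set (ProjSpace K N)) : Prop :=
  ∃ n : ℕ, projDim X = n ∧
    projDim (secantVariety s X) < ((min N (s * n + s - 1) : ℕ) : WithBot ℕ∞)

end SecantVariety

end

/-!
Adding one more point of `X` to a span raises the dimension of the secant variety by at most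
`dim X + 1`; this is the special case `Y = σₛ(X)` of the bound `dim J(Y, X) ≤ dim Y + dim X + 1` for
the join of two closed subsets of `ℙ^N`. So the expected dimension is missed by `σₛ₊₁(X)` as soon as
it is missed by `σₛ(X)`, and the bound by `N` is strict because a proper closed subset of `ℙ^N` has
smaller dimension.

The bound for the join compares the topological Krull dimension with systems of linear forms.

* If `dim Y < m`, then some `m` linear forms have no common zero on `Y`: each hyperplane can be
  chosen so as to contain no irreducible component of what is left, which lowers the dimension
  (`exists_linearForm_of_projDim_lt`).
* Forms chosen in this way for `Y` and for `X`, `m + n` of them in all, have only the origin as a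
  common zero on the product of the affine cones over `Y` and `X`. By the Nullstellensatz and a
  graded Nakayama argument the coordinate ring of this product is integral over these forms
  (`isIntegral_comp_aeval_of_forall_eval_eq_zero`).
* The addition map from this product is dominant onto the cone over the join, so the coordinate ring
  of that cone embeds in a ring that is integral over the image of a polynomial ring in `m + n`
  variables. By Noether normalization and a comparison of transcendence degrees it has Krull
  dimension at most `m + n` (`ringKrullDim_le_card_of_injective_of_isIntegral`).
* A chain of irreducible closed subsets of the join gives a chain of homogeneous primes, which the
  irrelevant ideal makes longer by one (`projDim_add_one_le_ringKrullDim_quotient`). Hence the join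
  has dimension less than `m + n`.
-/

noncomputable section

namespace SecantVariety

/-! ### Krull dimension and integral extensions -/

section

theorem ringKrullDim_le_of_isIntegral {R S : Type*} [CommRing R] [CommRing S] (f : R →+* S)
    (hf : f.IsIntegral) : ringKrullDim S ≤ ringKrullDim R := by
  refine Order.krullDim_le_of_strictMono (PrimeSpectrum.comap f) fun p q hpq => ?_
  algebraize [f]
  exact Ideal.IsIntegral.comap_lt_comap (R := R) hpq

/-- If `S` is a domain integral over the image of a polynomial ring in the variables `ι`, then at
most `#ι` elements of `S` are algebraically independent. -/
theorem trdeg_le_card_of_isIntegral {k S ι : Type*} [Field k] [CommRing S] [IsDomain S]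
    [Algebra k S] [Fintype ι] (g : MvPolynomial ι k →ₐ[k] S) (hg : g.IsIntegral) :
    Algebra.trdeg k S ≤ Fintype.card ι := by
  classical
  let s : Set S := Set.range fun i => g (MvPolynomial.X i)
  have hs : ∀ p, g p ∈ Algebra.adjoin k s := by
    intro p
    rw [Algebra.adjoin_range_eq_range_aeval]
    exact ⟨p, DFunLike.congr_fun (MvPolynomial.algHom_ext (fun i => by simp)) p⟩
  have : Algebra.IsIntegral (Algebra.adjoin k s) S := by
    refine ⟨fun x => ?_⟩
    obtain ⟨p, hp, hpx⟩ := hg x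
    refine ⟨p.map (g.codRestrict _ hs).toRingHom, hp.map _, ?_⟩
    rw [Polynomial.eval₂_map]
    exact hpx
  refine (Algebra.IsAlgebraic.trdeg_le_cardinalMk k s).trans ?_
  have h1 : Fintype.card s ≤ Fintype.card ι := Fintype.card_range_le _
  rw [Cardinal.mk_fintype]
  exact_mod_cast h1

/-- A finitely generated `k`-algebra contained in an algebra that is integral over the image of a
polynomial ring in `c` variables has Krull dimension at most `c`. -/
theorem ringKrullDim_le_card_of_injective_of_isIntegral {k A B ι : Type*} [Field k] [CommRing A]
    [CommRing B] [Algebra k A] [Algebra k B] [Algebra.FiniteType k A] [Fintype ι]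
    (f : A →ₐ[k] B) (hf : Function.Injective f) (g : MvPolynomial ι k →ₐ[k] B)
    (hg : g.IsIntegral) : ringKrullDim A ≤ Fintype.card ι := by
  nontriviality A
  obtain ⟨s, n, hn, hn'⟩ := exists_integral_inj_algHom_of_fg k A
  have h1 : ringKrullDim A ≤ s := by
    refine (ringKrullDim_le_of_isIntegral n.toRingHom hn').trans ?_
    rw [MvPolynomial.ringKrullDim_of_isNoetherianRing, ringKrullDim_eq_zero_of_field]
    simp
  refine h1.trans ?_
  have hinj : Function.Injective (f.comp n) := hf.comp hn
  -- A prime `Q` of `B` that contracts to zero in the polynomial ring of the normalization.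
  obtain ⟨Q, hQ, hQn⟩ := Ideal.exists_comap_eq_of_mem_minimalPrimes_of_injective
    (f := (f.comp n).toRingHom) hinj ⊥ (by
      rw [IsDomain.minimalPrimes_eq_singleton_bot]
      rfl)
  have h2 : Function.Injective ((Ideal.Quotient.mkₐ k Q).comp (f.comp n)) := by
    rw [injective_iff_map_eq_zero]
    intro p hp
    have : p ∈ Q.comap (f.comp n).toRingHom := 
      Ideal.Quotient.eq_zero_iff_mem (I := Q) |>.mp hp
    rwa [hQn] at this
  have h3 := lift_trdeg_le_of_injective _ h2
  have h4 := trdeg_le_card_of_isIntegral ((Ideal.Quotient.mkₐ k Q).comp g)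
    (hg.trans _ _ (RingHom.isIntegral_of_surjective _ Ideal.Quotient.mk_surjective))
  rw [MvPolynomial.trdeg_of_isDomain] at h3
  have h5 := h3.trans (Cardinal.lift_le.mpr h4)
  simp only [Cardinal.mk_fin, Cardinal.lift_natCast, Nat.cast_le] at h5
  exact_mod_cast h5

end

/-! ### Integrality over linear forms without a common zero -/

section

open MvPolynomial

theorem homogeneousComponent_mul_of_isHomogeneous {R σ : Type*} [CommSemiring R] (d : ℕ) {e : ℕ}
    (p : MvPolynomial σ R) {q : MvPolynomial σ R} (hq : q.IsHomogeneous e) :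
    homogeneousComponent (d + e) (p * q) = homogeneousComponent d p * q := by
  induction p using MvPolynomial.induction_on' with
  | monomial m a =>
    have hm := isHomogeneous_monomial (n := m.degree) (d := m) a rfl
    rw [homogeneousComponent_of_mem (hm.mul hq), homogeneousComponent_of_mem hm]
    simp only [add_left_inj, ite_mul, zero_mul]
  | add p p' hp hp' => simp only [add_mul, map_add, hp, hp']

variable {K σ ι : Type*} [Field K]

/-- A homogeneous ideal `I` and linear forms `L i` without a nontrivial common zero generate an
ideal that contains a power of the irrelevant ideal; so every homogeneous polynomial of large degree
is, modulo `I`, a combination of the `L i` with homogeneous coefficients of degree one less. -/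
theorem exists_sub_sum_mul_mem_of_forall_eval_eq_zero [IsAlgClosed K] [Finite σ] [Fintype ι]
    {I : Ideal (MvPolynomial σ K)} (hI : ∀ p ∈ I, ∀ d, homogeneousComponent d p ∈ I)
    {L : ι → MvPolynomial σ K} (hL : ∀ i, (L i).IsHomogeneous 1)
    (h0 : ∀ v : σ → K, (∀ p ∈ I, eval v p = 0) → (∀ i, eval v (L i) = 0) → v = 0) :
    ∃ M : ℕ, ∀ d, M ≤ d → ∀ h : MvPolynomial σ K, h.IsHomogeneous (d + 1) →
      ∃ g : ι → MvPolynomial σ K, (∀ i, (g i).IsHomogeneous d) ∧ h - ∑ i, g i * L i ∈ I := by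
  classical
  let J : Ideal (MvPolynomial σ K) := I ⊔ Ideal.span (Set.range L)
  have hrad : Ideal.span (Set.range (X : σ → MvPolynomial σ K)) ≤ J.radical := by
    rw [← vanishingIdeal_zeroLocus_eq_radical (K := K), Ideal.span_le]
    rintro _ ⟨i, rfl⟩ v hv
    have : v = 0 := h0 v
      (fun p hp => by simpa [aeval_eq_eval] using hv p (Ideal.mem_sup_left hp))
      (fun i => by
        simpa [aeval_eq_eval] using hv _ (Ideal.mem_sup_right (Ideal.subset_span ⟨i, rfl⟩)))
    simp [this]
  obtain ⟨M, hM⟩ := Ideal.exists_pow_le_of_le_radical_of_fg hrad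
    (IsNoetherian.noetherian _)
  refine ⟨M, fun d hd h hh => ?_⟩
  have hmem : h ∈ J := by
    refine hM ?_
    rw [h.as_sum]
    refine Ideal.sum_mem _ fun m hm => ?_
    have hdeg : m.degree = d + 1 := by
      rw [Finsupp.degree_eq_weight_one]
      exact hh (mem_support_iff.mp hm)
    have : (monomial m (coeff m h)) ∈ (Ideal.span (Set.range (X : σ → MvPolynomial σ K))) ^
        (d + 1) := by
      rw [monomial_eq]
      refine Ideal.mul_mem_left _ _ ?_
      rw [← hdeg, Finsupp.degree_apply, ← Finset.prod_pow_eq_pow_sum]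
      exact Ideal.prod_mem_prod fun i _ =>
        Ideal.pow_mem_pow (Ideal.subset_span (Set.mem_range_self i)) _
    exact Ideal.pow_le_pow_right (by omega) this
  obtain ⟨p, hp, q, hq, rfl⟩ := Submodule.mem_sup.mp hmem
  obtain ⟨c, rfl⟩ := (Ideal.mem_span_range_iff_exists_fun).mp hq
  refine ⟨fun i => homogeneousComponent d (c i), fun i => homogeneousComponent_isHomogeneous _ _,
    ?_⟩
  rw [← homogeneousComponent_eq_self hh, map_add, map_sum]
  simp only [homogeneousComponent_mul_of_isHomogeneous d _ (hL _), add_sub_cancel_right]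
  exact hI p hp _

/-- Graded Nakayama: if linear forms have no nontrivial common zero on the zero locus of a
homogeneous ideal `I`, then a quotient of the polynomial ring in which `I` vanishes is integral over
these forms. -/
theorem isIntegral_comp_aeval_of_forall_eval_eq_zero [IsAlgClosed K] [Finite σ] [Fintype ι]
    {I : Ideal (MvPolynomial σ K)} (hI : ∀ p ∈ I, ∀ d, homogeneousComponent d p ∈ I)
    {L : ι → MvPolynomial σ K} (hL : ∀ i, (L i).IsHomogeneous 1)
    (h0 : ∀ v : σ → K, (∀ p ∈ I, eval v p = 0) → (∀ i, eval v (L i) = 0) → v = 0)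
    {B : Type*} [CommRing B] [Algebra K B] (π : MvPolynomial σ K →ₐ[K] B)
    (hπ : Function.Surjective π) (hπI : ∀ p ∈ I, π p = 0) :
    (π.comp (aeval L)).IsIntegral := by
  obtain ⟨M, hM⟩ := exists_sub_sum_mul_mem_of_forall_eval_eq_zero hI hL h0
  algebraize [(π.comp (aeval L)).toRingHom]
  have hsmul : ∀ (p : MvPolynomial ι K) (x : MvPolynomial σ K),
      p • π x = π (aeval L p * x) := fun p x => by
    rw [Algebra.smul_def, map_mul]
    rfl
  -- The images of the finitely many monomials of degree at most `M` generate `B`.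
  let s : Set B := (fun m : σ →₀ ℕ => π (monomial m 1)) '' {m | m.degree ≤ M}
  have hs : s.Finite := (Finsupp.finite_of_degree_le M).image _
  let T := Submodule.span (MvPolynomial ι K) s
  have hT : ∀ d, ∀ h : MvPolynomial σ K, h.IsHomogeneous d → π h ∈ T := by
    intro d
    induction d using Nat.strong_induction_on with
    | _ d ih =>
      intro h hh
      rcases Nat.lt_or_ge M d with hd | hd
      · obtain ⟨e, rfl⟩ : ∃ e, d = e + 1 := ⟨d - 1, by omega⟩
        obtain ⟨g, hg, hgI⟩ := hM e (by omega) h hh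
        have h1 := hπI _ hgI
        rw [map_sub, sub_eq_zero] at h1
        rw [h1, map_sum]
        refine Submodule.sum_mem _ fun i _ => ?_
        have : π (g i * L i) = (X i : MvPolynomial ι K) • π (g i) := by
          rw [hsmul, aeval_X, mul_comm]
        rw [this]
        exact T.smul_mem _ (ih e (by omega) _ (hg i))
      · rw [h.as_sum, map_sum]
        refine Submodule.sum_mem _ fun m hm => ?_
        have h1 : π (monomial m (coeff m h))
            = (C (coeff m h) : MvPolynomial ι K) • π (monomial m 1) := by
          rw [hsmul, aeval_C, algebraMap_eq, C_mul_monomial, mul_one]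
        rw [h1]
        refine T.smul_mem _ (Submodule.subset_span ⟨m, ?_, rfl⟩)
        have h2 : m.degree = d := by
          rw [Finsupp.degree_eq_weight_one]
          exact hh (mem_support_iff.mp hm)
        exact h2.trans_le hd
  have hfin : Module.Finite (MvPolynomial ι K) B := by
    refine ⟨Submodule.fg_def.mpr ⟨s, hs, eq_top_iff.mpr ?_⟩⟩
    rintro x -
    obtain ⟨x, rfl⟩ := hπ x
    rw [← sum_homogeneousComponent x, map_sum]
    exact Submodule.sum_mem _ fun d _ => hT d _ (homogeneousComponent_isHomogeneous _ _)
  exact fun x => Algebra.IsIntegral.isIntegral (R := MvPolynomial ι K) x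

end

/-! ### Homogeneous primes of irreducible closed subsets -/

section

open MvPolynomial

variable {K σ : Type*} [Field K] {N : ℕ}

/-- The ideal generated by the homogeneous polynomials that vanish on a set `C` of vectors. For a
cone over an infinite field it is the ideal of all polynomials vanishing on `C`. -/
def homogeneousVanishingIdeal (C : Set (σ → K)) : Ideal (MvPolynomial σ K) :=
  Ideal.span {f | (∃ d, f.IsHomogeneous d) ∧ ∀ v ∈ C, eval v f = 0}

theorem mem_homogeneousVanishingIdeal_of_isHomogeneous {C : Set (σ → K)} {f : MvPolynomial σ K}
    {d : ℕ} (hf : f.IsHomogeneous d) (h : ∀ v ∈ C, eval v f = 0) :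
    f ∈ homogeneousVanishingIdeal C :=
  Ideal.subset_span ⟨⟨d, hf⟩, h⟩

theorem eval_eq_zero_of_mem_homogeneousVanishingIdeal {C : Set (σ → K)} {f : MvPolynomial σ K}
    (hf : f ∈ homogeneousVanishingIdeal C) {v : σ → K} (hv : v ∈ C) : eval v f = 0 := by
  have : homogeneousVanishingIdeal C ≤ RingHom.ker (eval v) :=
    Ideal.span_le.mpr fun g hg => hg.2 v hv
  exact this hf

theorem homogeneousVanishingIdeal_antitone :
    Antitone (homogeneousVanishingIdeal : Set (σ → K) → Ideal (MvPolynomial σ K)) :=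
  fun _ _ h => Ideal.span_mono fun _ hf => ⟨hf.1, fun v hv => hf.2 v (h hv)⟩

attribute [local instance] MvPolynomial.gradedAlgebra in
theorem isHomogeneous_homogeneousVanishingIdeal (C : Set (σ → K)) :
    (homogeneousVanishingIdeal C).IsHomogeneous (homogeneousSubmodule σ K) :=
  Ideal.homogeneous_span _ _ fun _ hf => hf.1

attribute [local instance] MvPolynomial.gradedAlgebra in
theorem homogeneousComponent_mem_homogeneousVanishingIdeal {C : Set (σ → K)}
    {f : MvPolynomial σ K} (hf : f ∈ homogeneousVanishingIdeal C) (d : ℕ) :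
    homogeneousComponent d f ∈ homogeneousVanishingIdeal C := by
  rw [← MvPolynomial.decomposition.decompose'_apply]
  exact isHomogeneous_homogeneousVanishingIdeal C d hf

attribute [local instance] MvPolynomial.gradedAlgebra in
theorem isPrime_homogeneousVanishingIdeal {C : Set (σ → K)} (hne : C.Nonempty)
    (h : ∀ f g : MvPolynomial σ K, ∀ d e : ℕ, f.IsHomogeneous d → g.IsHomogeneous e →
      (∀ v ∈ C, eval v (f * g) = 0) → (∀ v ∈ C, eval v f = 0) ∨ ∀ v ∈ C, eval v g = 0) :
    (homogeneousVanishingIdeal C).IsPrime := by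
  refine (isHomogeneous_homogeneousVanishingIdeal C).isPrime_of_homogeneous_mem_or_mem ?_ ?_
  · rw [Ideal.ne_top_iff_one]
    intro h1
    obtain ⟨v, hv⟩ := hne
    simpa using eval_eq_zero_of_mem_homogeneousVanishingIdeal h1 hv
  · rintro f g ⟨d, hd⟩ ⟨e, he⟩ hfg
    exact (h f g d e hd he fun v hv =>
      eval_eq_zero_of_mem_homogeneousVanishingIdeal hfg hv).imp
        (mem_homogeneousVanishingIdeal_of_isHomogeneous hd)
        (mem_homogeneousVanishingIdeal_of_isHomogeneous he)

/-- The affine cone over a subset of `ℙ^N`. It contains the origin, also when `Z` is empty. -/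
def affineCone (Z : Set (ProjSpace K N)) : Set (Fin (N + 1) → K) :=
  {v | ∀ hv : v ≠ 0, Projectivization.mk K v hv ∈ Z}

theorem zero_mem_affineCone (Z : Set (ProjSpace K N)) : (0 : Fin (N + 1) → K) ∈ affineCone Z :=
  fun h => (h rfl).elim

theorem rep_mem_affineCone_iff {Z : Set (ProjSpace K N)} {P : ProjSpace K N} :
    P.rep ∈ affineCone Z ↔ P ∈ Z := by
  refine ⟨fun h => by simpa using h P.rep_nonzero, fun h hv => by simpa using h⟩

theorem smul_mem_affineCone {Z : Set (ProjSpace K N)} {v : Fin (N + 1) → K}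
    (hv : v ∈ affineCone Z) (a : K) : a • v ∈ affineCone Z := by
  intro h
  have hv0 : v ≠ 0 := right_ne_zero_of_smul h
  have : Projectivization.mk K (a • v) h = Projectivization.mk K v hv0 :=
    (Projectivization.mk_eq_mk_iff' K _ _ _ _).mpr ⟨a, rfl⟩
  rw [this]
  exact hv hv0

theorem affineCone_mono : Monotone (affineCone : Set (ProjSpace K N) → Set (Fin (N + 1) → K)) :=
  fun _ _ h _ hv hv0 => h (hv hv0)

theorem isClosed_projZeroLocus_singleton {f : MvPolynomial (Fin (N + 1)) K} {d : ℕ}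
    (hf : f.IsHomogeneous d) : IsClosed (projZeroLocus {f} : Set (ProjSpace K N)) :=
  (isClosed_iff _).mpr ⟨_, by
    rintro _ rfl
    exact ⟨d, hf⟩, rfl⟩

theorem subset_projZeroLocus_singleton_iff {Z : Set (ProjSpace K N)}
    {f : MvPolynomial (Fin (N + 1)) K} {d : ℕ} (hf : f.IsHomogeneous d) :
    Z ⊆ projZeroLocus {f} ↔ ∀ v ∈ affineCone Z, v ≠ 0 → eval v f = 0 := by
  constructor
  · intro h v hv hv0
    exact (eval_rep_eq_zero_iff hf v hv0).mp (h (hv hv0) f rfl)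
  · rintro h P hP _ rfl
    exact h _ (rep_mem_affineCone_iff.mpr hP) P.rep_nonzero

theorem exists_eval_ne_zero_of_notMem {Z : Set (ProjSpace K N)} (hZ : IsClosed Z)
    {v : Fin (N + 1) → K} (hv : v ∉ affineCone Z) :
    ∃ f ∈ homogeneousVanishingIdeal (affineCone Z), eval v f ≠ 0 := by
  obtain ⟨S, hS, rfl⟩ := (isClosed_iff Z).mp hZ
  simp only [affineCone, Set.mem_ofPred_eq, not_forall] at hv
  obtain ⟨hv0, hv⟩ := hv
  simp only [projZeroLocus, Set.mem_ofPred_eq, not_forall] at hv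
  obtain ⟨f, hf, hfv⟩ := hv
  obtain ⟨d, hd⟩ := hS f hf
  rw [eval_rep_eq_zero_iff hd v hv0] at hfv
  obtain ⟨i, hi⟩ := Function.ne_iff.mp hv0
  -- The factor `X i` makes a nonzero constant in `S` vanish at the origin.
  refine ⟨f * X i, mem_homogeneousVanishingIdeal_of_isHomogeneous
    (hd.mul (isHomogeneous_X K i)) fun w hw => ?_, by simpa using ⟨hfv, hi⟩⟩
  rcases eq_or_ne w 0 with rfl | hw0
  · simp
  · rw [map_mul, (eval_rep_eq_zero_iff hd w hw0).mp (hw hw0 f hf), zero_mul]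

theorem mem_affineCone_of_forall_eval_eq_zero {Z : Set (ProjSpace K N)} (hZ : IsClosed Z)
    {v : Fin (N + 1) → K}
    (hv : ∀ f ∈ homogeneousVanishingIdeal (affineCone Z), eval v f = 0) : v ∈ affineCone Z := by
  by_contra h
  obtain ⟨f, hf, hfv⟩ := exists_eval_ne_zero_of_notMem hZ h
  exact hfv (hv f hf)

theorem homogeneousVanishingIdeal_affineCone_lt {Z W : Set (ProjSpace K N)} (hZ : IsClosed Z)
    (h : Z ⊂ W) :
    homogeneousVanishingIdeal (affineCone W) < homogeneousVanishingIdeal (affineCone Z) := by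
  obtain ⟨hsub, P, hPW, hPZ⟩ := Set.ssubset_iff_exists.mp h
  obtain ⟨f, hf, hfP⟩ := exists_eval_ne_zero_of_notMem hZ (mt rep_mem_affineCone_iff.mp hPZ)
  exact lt_of_le_of_ne (homogeneousVanishingIdeal_antitone (affineCone_mono hsub)) fun h =>
    hfP (eval_eq_zero_of_mem_homogeneousVanishingIdeal (h ▸ hf)
      (rep_mem_affineCone_iff.mpr hPW))

/-- The ideal of an irreducible subset of `ℙ^N` is prime. The empty set is allowed: its ideal is the
irrelevant ideal. -/
theorem isPrime_homogeneousVanishingIdeal_affineCone {Z : Set (ProjSpace K N)}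
    (hZ : IsPreirreducible Z) : (homogeneousVanishingIdeal (affineCone Z)).IsPrime := by
  refine isPrime_homogeneousVanishingIdeal ⟨0, zero_mem_affineCone Z⟩
    fun f g d e hf hg hfg => ?_
  -- A homogeneous polynomial that does not vanish at the origin is a nonzero constant.
  have key : ∀ (p q : MvPolynomial (Fin (N + 1)) K) (d : ℕ), p.IsHomogeneous d →
      (∀ v ∈ affineCone Z, eval v (p * q) = 0) → eval 0 p ≠ 0 →
      ∀ v ∈ affineCone Z, eval v q = 0 := by
    intro p q d hp hpq hp0 v hv
    have hd : d = 0 := by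
      by_contra hd
      refine hp0 ?_
      simpa [constantCoeff_eq] using hp.coeff_eq_zero (d := 0) (by simpa using Ne.symm hd)
    subst hd
    rw [← totalDegree_zero_iff_isHomogeneous, totalDegree_eq_zero_iff_eq_C] at hp
    have := hpq v hv
    rw [hp] at this hp0
    simp only [map_mul, eval_C, mul_eq_zero] at this hp0
    exact this.resolve_left hp0
  by_cases hf0 : eval 0 f = 0
  · by_cases hg0 : eval 0 g = 0
    · have hcover : Z ⊆ projZeroLocus {f} ∪ projZeroLocus {g} := by
        intro P hP
        have := hfg _ (rep_mem_affineCone_iff.mpr hP)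
        rw [map_mul, mul_eq_zero] at this
        simpa [projZeroLocus] using this
      refine (isPreirreducible_iff_isClosed_union_isClosed.mp hZ _ _
        (isClosed_projZeroLocus_singleton hf) (isClosed_projZeroLocus_singleton hg) hcover).imp
          (fun h v hv => ?_) (fun h v hv => ?_)
      · rcases eq_or_ne v 0 with rfl | hv0
        · exact hf0
        · exact (subset_projZeroLocus_singleton_iff hf).mp h v hv hv0
      · rcases eq_or_ne v 0 with rfl | hv0
        · exact hg0
        · exact (subset_projZeroLocus_singleton_iff hg).mp h v hv hv0
    · exact Or.inl (key g f e hg (by simpa only [mul_comm] using hfg) hg0)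
  · exact Or.inr (key f g d hf hfg hf0)

/-- A closed subset of `ℙ^N` whose ideal contains `J` has dimension less than that of the ring of
polynomials modulo `J`: a chain of irreducible closed subsets gives a chain of primes, and the
irrelevant ideal can be put on top of it. -/
theorem projDim_add_one_le_ringKrullDim_quotient {Z : Set (ProjSpace K N)} (hZ : IsClosed Z)
    {J : Ideal (MvPolynomial (Fin (N + 1)) K)}
    (hJ : J ≤ homogeneousVanishingIdeal (affineCone Z)) :
    projDim Z + 1 ≤ ringKrullDim (MvPolynomial (Fin (N + 1)) K ⧸ J) := by
  rcases Z.eq_empty_or_nonempty with rfl | hne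
  · have : IsEmpty (TopologicalSpace.IrreducibleCloseds (∅ : Set (ProjSpace K N))) :=
      ⟨fun W => let ⟨x, _⟩ := W.isIrreducible.nonempty; x.2⟩
    simp [projDim, topologicalKrullDim, Order.krullDim_eq_bot]
  have : Nonempty (TopologicalSpace.IrreducibleCloseds Z) :=
    let ⟨x, hx⟩ := hne
    ⟨⟨closure {⟨x, hx⟩}, isIrreducible_singleton.closure, isClosed_closure⟩⟩
  rw [projDim, topologicalKrullDim, ← Order.krullDim_withBot, ringKrullDim_quotient,
    ← Order.krullDim_orderDual]
  let A : WithBot (TopologicalSpace.IrreducibleCloseds Z) → Set (ProjSpace K N) :=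
    WithBot.recBotCoe ∅ fun W => Subtype.val '' (W : Set Z)
  have hAclosed : ∀ W, IsClosed (A W) := by
    intro W
    cases W with
    | bot => exact isClosed_empty
    | coe W => exact hZ.isClosedEmbedding_subtypeVal.isClosedMap _ W.isClosed
  have hAirr : ∀ W, IsPreirreducible (A W) := by
    intro W
    cases W with
    | bot => exact isPreirreducible_empty
    | coe W => exact W.isIrreducible.isPreirreducible.image _ continuous_subtype_val.continuousOn
  have hAsub : ∀ W, A W ⊆ Z := by
    intro W
    cases W with
    | bot => exact Set.empty_subset _
    | coe W => exact Subtype.coe_image_subset _ _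
  have hAmono : StrictMono A := by
    intro V W hVW
    cases W with
    | bot => exact (not_lt_bot hVW).elim
    | coe W =>
      cases V with
      | bot => exact (W.isIrreducible.nonempty.image _).empty_ssubset
      | coe V =>
        have h : V < W := WithBot.coe_lt_coe.mp hVW
        exact Subtype.val_injective.image_strictMono (SetLike.coe_ssubset_coe.mpr h)
  exact Order.krullDim_le_of_strictMono
    (fun W => ⟨⟨_, isPrime_homogeneousVanishingIdeal_affineCone (hAirr (OrderDual.ofDual W))⟩,
      hJ.trans (homogeneousVanishingIdeal_antitone (affineCone_mono (hAsub _)))⟩)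
    fun _ W hVW => homogeneousVanishingIdeal_affineCone_lt (hAclosed (OrderDual.ofDual W))
      (hAmono hVW)

theorem lt_natCast_of_add_one_le {x : WithBot ℕ∞} {n : ℕ} (h : x + 1 ≤ n) : x < n := by
  induction x with
  | bot => exact WithBot.bot_lt_coe _
  | coe x =>
    have h' : x + 1 ≤ (n : ℕ∞) := by exact_mod_cast h
    exact_mod_cast (ENat.add_one_le_iff (fun hx => by simp [hx] at h')).mp h'

/-- A proper closed subset of `ℙ^N` has dimension less than `N`. -/
theorem projDim_lt_of_ne_univ [Infinite K] {Z : Set (ProjSpace K N)} (hZ : IsClosed Z)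
    (hne : Z ≠ Set.univ) : projDim Z < N := by
  obtain ⟨P, hP⟩ := (Set.ne_univ_iff_exists_notMem _).mp hne
  obtain ⟨f, hf, hfP⟩ := exists_eval_ne_zero_of_notMem hZ (mt rep_mem_affineCone_iff.mp hP)
  have hf0 : f ≠ 0 := by
    rintro rfl
    simp at hfP
  have h1 := projDim_add_one_le_ringKrullDim_quotient hZ
    ((Ideal.span_singleton_le_iff_mem _).mpr hf)
  have h2 := ringKrullDim_quotient_succ_le_of_nonZeroDivisor (mem_nonZeroDivisors_of_ne_zero hf0)
  rw [MvPolynomial.ringKrullDim_of_isNoetherianRing, ringKrullDim_eq_zero_of_field] at h2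
  have h3 : projDim Z + 1 + 1 ≤ ((N + 1 : ℕ) : WithBot ℕ∞) := by
    refine (add_le_add_left h1 1).trans (h2.trans ?_)
    simp
  have h4 := lt_natCast_of_add_one_le h3
  rw [Nat.cast_add, Nat.cast_one] at h4
  exact lt_of_add_lt_add_right h4

end

/-! ### Cutting down the dimension by hyperplanes -/

section

open TopologicalSpace

/-- A closed subset that contains no irreducible component has smaller dimension. -/
theorem topologicalKrullDim_lt_of_forall_not_subset {Y : Type*} [TopologicalSpace Y] {H : Set Y}
    (hH : IsClosed H) (hcomp : ∀ t ∈ irreducibleComponents Y, ¬ t ⊆ H) {n : ℕ}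
    (h : topologicalKrullDim Y < ((n + 1 : ℕ) : WithBot ℕ∞)) : topologicalKrullDim H < n := by
  rw [topologicalKrullDim, Order.krullDim_lt_coe_iff] at h ⊢
  intro l
  let l' : LTSeries (IrreducibleCloseds Y) :=
    l.map _ (IrreducibleCloseds.map_strictMono_of_isInducing Topology.IsInducing.subtypeVal)
  have hlast : (l'.last : Set Y) ⊆ H := by
    refine closure_minimal ?_ hH
    exact Subtype.coe_image_subset _ _
  obtain ⟨t, ht, hlt⟩ :=
    exists_mem_irreducibleComponents_subset_of_isIrreducible _ l'.last.isIrreducible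
  let T : IrreducibleCloseds Y := ⟨t, ht.1, isClosed_of_mem_irreducibleComponents t ht⟩
  have hT : l'.last < T := lt_of_le_of_ne hlt fun h => hcomp t ht (by
    have : (l'.last : Set Y) = t := congrArg SetLike.coe h
    exact this ▸ hlast)
  have := h (l'.snoc T hT)
  simpa [l'] using this

variable {K : Type*} [Field K] {N : ℕ}

instance noetherianSpace_projSpace : NoetherianSpace (ProjSpace K N) := by
  refine ((noetherianSpace_TFAE (ProjSpace K N)).out 0 1).mpr ?_
  have : StrictAnti fun Z : Closeds (ProjSpace K N) =>
      homogeneousVanishingIdeal (affineCone (Z : Set (ProjSpace K N))) :=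
    fun Z _ h => homogeneousVanishingIdeal_affineCone_lt Z.isClosed h
  exact this.wellFoundedLT

/-- The linear form with coefficient vector `a`. -/
def linearForm (a : Fin (N + 1) → K) : MvPolynomial (Fin (N + 1)) K :=
  ∑ i, MvPolynomial.C (a i) * MvPolynomial.X i

theorem isHomogeneous_linearForm (a : Fin (N + 1) → K) : (linearForm a).IsHomogeneous 1 :=
  MvPolynomial.IsHomogeneous.sum _ _ _ fun _ _ => MvPolynomial.isHomogeneous_C_mul_X _ _

theorem eval_linearForm (a v : Fin (N + 1) → K) :
    MvPolynomial.eval v (linearForm a) = ∑ i, a i * v i := by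
  simp [linearForm]

/-- Over an infinite field, finitely many nonempty subsets of `ℙ^N` admit a linear form that
vanishes identically on none of them. -/
theorem exists_linearForm_forall_not_subset [Infinite K] {S : Set (Set (ProjSpace K N))}
    (hS : S.Finite) (hne : ∀ t ∈ S, t.Nonempty) :
    ∃ a : Fin (N + 1) → K, ∀ t ∈ S, ¬ t ⊆ projZeroLocus {linearForm a} := by
  have := hS.to_subtype
  let p : S → Subspace K (Fin (N + 1) → K) := fun t =>
    { carrier := {a | ∀ P ∈ t.1, ∑ i, a i * P.rep i = 0}
      zero_mem' := by simp
      add_mem' := fun {a b} ha hb P hP => by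
        simp only [Pi.add_apply, add_mul, Finset.sum_add_distrib, ha P hP, hb P hP, add_zero]
      smul_mem' := fun c a ha P hP => by
        simp only [Pi.smul_apply, smul_eq_mul, mul_assoc, ← Finset.mul_sum, ha P hP, mul_zero] }
  by_contra! hcon
  obtain ⟨t, ht⟩ := Subspace.exists_eq_top_of_iUnion_eq_univ (p := p) (by
    refine Set.eq_univ_of_forall fun a => ?_
    obtain ⟨t, htS, ht⟩ := hcon a
    refine Set.mem_iUnion.mpr ⟨⟨t, htS⟩, fun P hP => ?_⟩
    rw [← eval_linearForm]
    exact ht hP _ rfl)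
  obtain ⟨P, hP⟩ := hne t t.2
  obtain ⟨i, hi⟩ := Function.ne_iff.mp P.rep_nonzero
  have h1 : Pi.single i 1 ∈ p t := ht ▸ Submodule.mem_top
  have h2 := h1 P hP
  simp only [Pi.single_apply, ite_mul, one_mul, zero_mul, Finset.sum_ite_eq',
    Finset.mem_univ, if_true] at h2
  exact hi h2

/-- A subspace of `ℙ^N` of dimension less than `n` is missed by the intersection of suitable `n`
hyperplanes: each hyperplane can be chosen to lower the dimension. -/
theorem exists_linearForm_of_topologicalKrullDim_lt [Infinite K] (n : ℕ) :
    ∀ {Y : Type*} [TopologicalSpace Y] (i : Y → ProjSpace K N), Topology.IsInducing i →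
      topologicalKrullDim Y < n →
      ∃ a : Fin n → Fin (N + 1) → K, ∀ y, ∃ j,
        MvPolynomial.eval (i y).rep (linearForm (a j)) ≠ 0 := by
  induction n with
  | zero =>
    intro Y _ i _ hY
    refine ⟨Fin.elim0, fun y => ?_⟩
    have : Nonempty (IrreducibleCloseds Y) :=
      ⟨⟨closure {y}, isIrreducible_singleton.closure, isClosed_closure⟩⟩
    exact absurd hY (not_lt.mpr Order.krullDim_nonneg)
  | succ n ih =>
    intro Y _ i hi hY
    have := hi.noetherianSpace
    obtain ⟨a, ha⟩ := exists_linearForm_forall_not_subset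
      (S := Set.image i '' irreducibleComponents Y)
      (NoetherianSpace.finite_irreducibleComponents.image _) (by
        rintro _ ⟨t, ht, rfl⟩
        exact ht.1.nonempty.image _)
    have hH := (isClosed_projZeroLocus_singleton (isHomogeneous_linearForm a)).preimage
      hi.continuous
    have hdim := topologicalKrullDim_lt_of_forall_not_subset hH (fun t ht hsub =>
      ha _ ⟨t, ht, rfl⟩ (Set.image_subset_iff.mpr hsub)) hY
    obtain ⟨b, hb⟩ := ih _ (hi.comp Topology.IsInducing.subtypeVal) hdim
    refine ⟨Fin.cons a b, fun y => ?_⟩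
    by_cases hy : MvPolynomial.eval (i y).rep (linearForm a) = 0
    · obtain ⟨j, hj⟩ := hb ⟨y, by
        rintro _ rfl
        exact hy⟩
      exact ⟨j.succ, by simpa using hj⟩
    · exact ⟨0, by simpa using hy⟩

/-- A closed subset `Z` of `ℙ^N` of dimension less than `n` admits `n` linear forms whose only
common zero on the affine cone over `Z` is the origin. -/
theorem exists_linearForm_of_projDim_lt [Infinite K] {Z : Set (ProjSpace K N)} {n : ℕ}
    (hZ : projDim Z < n) : ∃ a : Fin n → Fin (N + 1) → K,
      ∀ v ∈ affineCone Z, (∀ j, MvPolynomial.eval v (linearForm (a j)) = 0) → v = 0 := by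
  obtain ⟨a, ha⟩ := exists_linearForm_of_topologicalKrullDim_lt n (Subtype.val : Z → ProjSpace K N)
    Topology.IsInducing.subtypeVal hZ
  refine ⟨a, fun v hv hj => ?_⟩
  by_contra hv0
  obtain ⟨j, hja⟩ := ha ⟨_, hv hv0⟩
  exact hja ((eval_rep_eq_zero_iff (isHomogeneous_linearForm _) v hv0).mpr (hj j))

end

/-! ### Joins and secant varieties -/

section

open MvPolynomial

theorem homogeneousComponent_aeval_of_isHomogeneous_one {R σ τ : Type*} [CommSemiring R]
    {g : σ → MvPolynomial τ R} (hg : ∀ i, (g i).IsHomogeneous 1) (d : ℕ) (p : MvPolynomial σ R) :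
    homogeneousComponent d (aeval g p) = aeval g (homogeneousComponent d p) := by
  induction p using MvPolynomial.induction_on' with
  | monomial m a =>
    have hm := isHomogeneous_monomial (n := m.degree) (d := m) a rfl
    have hm' := hm.aeval g hg
    rw [one_mul] at hm'
    rw [homogeneousComponent_of_mem hm', homogeneousComponent_of_mem hm]
    split_ifs <;> simp
  | add p q hp hq => simp only [map_add, hp, hq]

variable {K : Type*} [Field K] {N : ℕ}

/-- The product of the affine cones over `Y` and `X`, as a cone in the sum of two copies of
`K^(N+1)`. -/
def prodCone (Y X : Set (ProjSpace K N)) : Set (Fin (N + 1) ⊕ Fin (N + 1) → K) :=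
  {w | w ∘ Sum.inl ∈ affineCone Y ∧ w ∘ Sum.inr ∈ affineCone X}

/-- If the coordinates selected by `r` map `C` into the cone over a closed set `Y`, then they do the
same for the zero locus of the ideal of `C`. -/
theorem comp_mem_affineCone_of_forall_eval_eq_zero {Y : Set (ProjSpace K N)} {τ : Type*}
    {C : Set (τ → K)} {r : Fin (N + 1) → τ} (hY : IsClosed Y)
    (hC : ∀ w ∈ C, w ∘ r ∈ affineCone Y) {w : τ → K}
    (hw : ∀ p ∈ homogeneousVanishingIdeal C, eval w p = 0) : w ∘ r ∈ affineCone Y := by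
  refine mem_affineCone_of_forall_eval_eq_zero hY fun f hf => ?_
  have : homogeneousVanishingIdeal (affineCone Y) ≤
      (homogeneousVanishingIdeal C).comap (rename r) := by
    refine Ideal.span_le.mpr fun g hg => ?_
    obtain ⟨⟨d, hd⟩, hg⟩ := hg
    exact mem_homogeneousVanishingIdeal_of_isHomogeneous (d := d) hd.rename_isHomogeneous
      fun v hv => by
        rw [eval_rename]
        exact hg _ (hC v hv)
  rw [← eval_rename]
  exact hw _ (this hf)

/-- The homomorphism dual to the addition map from the product of the cones over `Y` and `X`: a
polynomial `f` is sent to the function `(y, x) ↦ f (y + x)` on this product. -/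
def addHom (Y X : Set (ProjSpace K N)) : MvPolynomial (Fin (N + 1)) K →ₐ[K]
    MvPolynomial (Fin (N + 1) ⊕ Fin (N + 1)) K ⧸ homogeneousVanishingIdeal (prodCone Y X) :=
  (Ideal.Quotient.mkₐ K _).comp
    (aeval fun i => MvPolynomial.X (Sum.inl i) + MvPolynomial.X (Sum.inr i))

/-- The linear forms that cut out the origin on the cones over `Y` and `X` together cut out the
origin on the product, so its coordinate ring is integral over them. -/
theorem ringKrullDim_quotient_ker_addHom_le [IsAlgClosed K] {Y X : Set (ProjSpace K N)}
    (hY : IsClosed Y) (hX : IsClosed X) {m n : ℕ} (hYm : projDim Y < m) (hXn : projDim X < n) :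
    ringKrullDim (MvPolynomial (Fin (N + 1)) K ⧸ RingHom.ker (addHom Y X)) ≤ (m + n : ℕ) := by
  obtain ⟨a, ha⟩ := exists_linearForm_of_projDim_lt hYm
  obtain ⟨b, hb⟩ := exists_linearForm_of_projDim_lt hXn
  let L : Fin m ⊕ Fin n → MvPolynomial (Fin (N + 1) ⊕ Fin (N + 1)) K :=
    Sum.elim (fun j => rename Sum.inl (linearForm (a j)))
      fun j => rename Sum.inr (linearForm (b j))
  have hL : ∀ j, (L j).IsHomogeneous 1 := by
    rintro (j | j)
    · exact (isHomogeneous_linearForm _).rename_isHomogeneous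
    · exact (isHomogeneous_linearForm _).rename_isHomogeneous
  have hint := isIntegral_comp_aeval_of_forall_eval_eq_zero
    (I := homogeneousVanishingIdeal (prodCone Y X))
    (fun p hp d => homogeneousComponent_mem_homogeneousVanishingIdeal hp d) hL
    (fun w hw hwL => by
      have hl := ha _ (comp_mem_affineCone_of_forall_eval_eq_zero (r := Sum.inl) hY
        (fun w hw => hw.1) hw)
        fun j => by
          rw [← eval_rename]
          exact hwL (Sum.inl j)
      have hr := hb _ (comp_mem_affineCone_of_forall_eval_eq_zero (r := Sum.inr) hX
        (fun w hw => hw.2) hw)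
        fun j => by
          rw [← eval_rename]
          exact hwL (Sum.inr j)
      funext i
      rcases i with i | i
      · exact congrFun hl i
      · exact congrFun hr i)
    (Ideal.Quotient.mkₐ K _) Ideal.Quotient.mk_surjective
    (fun p hp => Ideal.Quotient.eq_zero_iff_mem.mpr hp)
  have := ringKrullDim_le_card_of_injective_of_isIntegral (Ideal.kerLiftAlg (addHom Y X))
    (Ideal.kerLiftAlg_injective _) _ hint
  simpa using this

/-- If the sums of vectors over `Y` and `X` cover the cone over `A`, then a polynomial that vanishes
on all these sums vanishes on the cone over the closure of `A`. -/
theorem ker_addHom_le {Y X A : Set (ProjSpace K N)}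
    (hA : ∀ v ∈ affineCone A, ∃ y ∈ affineCone Y, ∃ x ∈ affineCone X, v = y + x) :
    RingHom.ker (addHom Y X) ≤ homogeneousVanishingIdeal (affineCone (closure A)) := by
  intro p hp
  have hp' : aeval (fun i => MvPolynomial.X (Sum.inl i) + MvPolynomial.X (Sum.inr i)) p ∈
      homogeneousVanishingIdeal (prodCone Y X) := Ideal.Quotient.eq_zero_iff_mem.mp hp
  rw [← sum_homogeneousComponent p]
  refine Ideal.sum_mem _ fun d _ => ?_
  have hd := homogeneousComponent_isHomogeneous d p
  have hvan : ∀ v ∈ affineCone A, eval v (homogeneousComponent d p) = 0 := by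
    intro v hv
    obtain ⟨y, hy, x, hx, rfl⟩ := hA v hv
    have h1 := homogeneousComponent_mem_homogeneousVanishingIdeal hp' d
    have h2 := eval_eq_zero_of_mem_homogeneousVanishingIdeal h1 (v := Sum.elim y x) ⟨hy, hx⟩
    rw [homogeneousComponent_aeval_of_isHomogeneous_one
      (fun i => (isHomogeneous_X K _).add (isHomogeneous_X K _))] at h2
    rw [← aeval_eq_eval, ← AlgHom.comp_apply, comp_aeval] at h2
    simp [aeval_eq_eval] at h2
    exact h2
  refine mem_homogeneousVanishingIdeal_of_isHomogeneous hd fun v hv => ?_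
  rcases eq_or_ne v 0 with rfl | hv0
  · exact hvan 0 (zero_mem_affineCone A)
  · exact (subset_projZeroLocus_singleton_iff hd).mp
      (closure_minimal ((subset_projZeroLocus_singleton_iff hd).mpr fun v hv _ => hvan v hv)
        (isClosed_projZeroLocus_singleton hd)) v hv hv0

/-- The dimension of a join: if every vector over `A` is the sum of a vector over `Y` and one over
`X`, then `dim A ≤ dim Y + dim X + 1`. The bounds `m` and `n` are strict, so that empty sets and sets
of dimension zero need no separate treatment. -/
theorem projDim_closure_lt_of_forall_eq_add [IsAlgClosed K] {Y X A : Set (ProjSpace K N)}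
    (hY : IsClosed Y) (hX : IsClosed X) {m n : ℕ} (hYm : projDim Y < m) (hXn : projDim X < n)
    (hA : ∀ v ∈ affineCone A, ∃ y ∈ affineCone Y, ∃ x ∈ affineCone X, v = y + x) :
    projDim (closure A) < (m + n : ℕ) := by
  have h1 := (projDim_add_one_le_ringKrullDim_quotient isClosed_closure (ker_addHom_le hA)).trans
    (ringKrullDim_quotient_ker_addHom_le hY hX hYm hXn)
  exact lt_natCast_of_add_one_le h1

theorem exists_sum_of_mk_mem_span {s : ℕ} {P : Fin s → ProjSpace K N} {v : Fin (N + 1) → K}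
    (hv : v ≠ 0) (h : Projectivization.mk K v hv ∈ Projectivization.Subspace.span (Set.range P)) :
    ∃ c : Fin s → K, v = ∑ i, c i • (P i).rep := by
  let W : Submodule K (Fin (N + 1) → K) := Submodule.span K (Set.range fun i => (P i).rep)
  have hW : Projectivization.Subspace.span (Set.range P) ≤ W.projectivization := by
    rw [Projectivization.Subspace.span_le_subspace_iff]
    rintro _ ⟨i, rfl⟩
    have : Projectivization.mk K (P i).rep (P i).rep_nonzero ∈ W.projectivization :=
      (Submodule.mk_mem_projectivization_iff _ _).mpr (Submodule.subset_span ⟨i, rfl⟩)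
    simpa using this
  have hvW : v ∈ W := (Submodule.mk_mem_projectivization_iff _ hv).mp (hW h)
  obtain ⟨c, hc⟩ := (Submodule.mem_span_range_iff_exists_fun K).mp hvW
  exact ⟨c, hc.symm⟩

theorem sum_smul_rep_mem_affineCone_span {s : ℕ} (P : Fin s → ProjSpace K N) (c : Fin s → K) :
    ∑ i, c i • (P i).rep ∈
      affineCone (Projectivization.Subspace.span (Set.range P) : Set (ProjSpace K N)) := by
  have : ∑ i, c i • (P i).rep ∈
      Projectivization.Subspace.submodule (Projectivization.Subspace.span (Set.range P)) := by
    refine Submodule.sum_mem _ fun i _ => Submodule.smul_mem _ _ ?_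
    rw [Projectivization.Subspace.mem_submodule_iff _ (P i).rep_nonzero, Projectivization.mk_rep]
    exact Projectivization.Subspace.subset_span _ ⟨i, rfl⟩
  exact fun h => (Projectivization.Subspace.mem_submodule_iff _ h).mp this

/-- A vector in the span of `s + 1` points of `X` is the sum of a vector over `σₛ(X)` and one over
`X`, where both may be zero. -/
theorem exists_eq_add_of_mem_affineCone_iUnion_span {X : Set (ProjSpace K N)} {s : ℕ}
    {v : Fin (N + 1) → K}
    (hv : v ∈ affineCone (⋃ (P : Fin (s + 1) → ProjSpace K N) (_ : ∀ i, P i ∈ X),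
      (Projectivization.Subspace.span (Set.range P) : Set (ProjSpace K N)))) :
    ∃ y ∈ affineCone (secantVariety s X), ∃ x ∈ affineCone X, v = y + x := by
  rcases eq_or_ne v 0 with rfl | hv0
  · exact ⟨0, zero_mem_affineCone _, 0, zero_mem_affineCone _, (add_zero 0).symm⟩
  obtain ⟨P, hPX, hP⟩ := Set.mem_iUnion₂.mp (hv hv0)
  obtain ⟨c, rfl⟩ := exists_sum_of_mk_mem_span hv0 hP
  rw [Fin.sum_univ_castSucc]
  refine ⟨_, ?_, _, smul_mem_affineCone (rep_mem_affineCone_iff.mpr (hPX _)) _, rfl⟩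
  refine affineCone_mono ?_ (sum_smul_rep_mem_affineCone_span (fun i => P (Fin.castSucc i)) _)
  exact fun Q hQ => subset_closure (Set.mem_iUnion₂.mpr ⟨_, fun i => hPX _, hQ⟩)

/-- Adding a point of `X` to the span raises the dimension by at most `dim X + 1`. -/
theorem projDim_secantVariety_succ_lt [IsAlgClosed K] {X : Set (ProjSpace K N)} (hX : IsClosed X)
    {s k n : ℕ} (hXn : projDim X = n) (hs : projDim (secantVariety s X) < k) :
    projDim (secantVariety (s + 1) X) < (k + (n + 1) : ℕ) :=
  projDim_closure_lt_of_forall_eq_add isClosed_closure hX hs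
    (hXn.trans_lt (Nat.cast_lt.mpr n.lt_succ_self))
    fun _ hv => exists_eq_add_of_mem_affineCone_iUnion_span hv

end

end SecantVariety

end

theorem mainTheorem3 {K : Type*} [Field K] [IsAlgClosed K] [CharZero K] {N : ℕ}
    (X : Set (SecantVariety.ProjSpace K N)) (hX : IsClosed X)
    (s : ℕ) (hs : 1 ≤ s)
    (hdef : SecantVariety.IsDefective s X)
    (hne : SecantVariety.secantVariety (s + 1) X ≠ Set.univ) :
    SecantVariety.IsDefective (s + 1) X := by
  obtain ⟨n, hn, hlt⟩ := hdef
  refine ⟨n, hn, ?_⟩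
  have h1 := SecantVariety.projDim_lt_of_ne_univ isClosed_closure hne
  have h2 := SecantVariety.projDim_secantVariety_succ_lt hX hn (k := s * n + s - 1)
    (hlt.trans_le (by exact_mod_cast min_le_right _ _))
  have h3 : s * n + s - 1 + (n + 1) = (s + 1) * n + (s + 1) - 1 := by
    have : (s + 1) * n = s * n + n := by ring
    omega
  rw [h3] at h2
  rcases min_choice N ((s + 1) * n + (s + 1) - 1) with h | h <;> rw [h]
  · exact h1
  · exact h2
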